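/- Theorem. Call a pair $a,b$ of elements of an integral domain $R$ an idempotent pair if $(a\ b)$ or $(b\ a)$ is the first row of an idempotent $2\times 2$ matrix over $R$ (equivalently, $a(1-a)\in bR$ or $b(1-b)\in aR$). Call $R$ a PRINC domain if every ideal of $R$ generated by an idempotent pair is principal, and seminormal if whenever $a,b\in R$ satisfy $a^2=b^3$ there is $c\in R$ with $c^3=a$ and $c^2=b$. Let $D$ be a seminormal PRINC domain. (i) Let $S$ be a commutative, cancellative, torsion-free additive semigroup with neutral element $0$ (torsion-free: $ns=nt$ with $n\ge 1$ implies $s=t$) which is locally cyclic, that is, for all $s_1,s_2\in S$ there is $s\in S$ with $s_1\mathbb N+s_2\mathbb N\subseteq s\mathbb N$, where $\mathbb N=\{0,1,2,\dots\}$. Then the semigroup ring $D[X;S]$ is a PRINC domain (in particular an integral domain). (ii) Let $R=D[X_n : n>0]/J$, where $J$ is the ideal generated by the elements $X_i-X_{i+1}(1+X_{i+1})$, $i>0$, and let $x_n$ be the residue class of $X_n$. Then $x_n=x_{n+1}(1+x_{n+1})$ for every $n>0$, $R=\bigcup_{n>0}D[x_n]$, and $R$ is a PRINC domain (in particular an integral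 domain). -/

import Mathlib

/-- `a, b` is an idempotent pair: `(a b)` or `(b a)` is the first row of an idempotent
`2 × 2` matrix with entries in `R`. -/
def IsIdempotentPair {R : Type*} [CommRing R] (a b : R) : Prop :=
  (∃ c d : R, IsIdempotentElem !![a, b; c, d]) ∨ (∃ c d : R, IsIdempotentElem !![b, a; c, d])

/-- The equivalent description of idempotent pairs through divisibility. -/
theorem isIdempotentPair_iff {R : Type*} [CommRing R] (a b : R) :
    IsIdempotentPair a b ↔ b ∣ a * (1 - a) ∨ a ∣ b * (1 - b) := by
  have key : ∀ x y : R, (∃ c d : R, IsIdempotentElem !![x, y; c, d]) ↔ y ∣ x * (1 - x) := by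
    intro x y
    constructor
    · rintro ⟨c, d, h⟩
      have h00 := congrFun (congrFun h 0) 0
      simp [Matrix.mul_apply, Fin.sum_univ_two] at h00
      exact ⟨c, by linear_combination -h00⟩
    · rintro ⟨r, h⟩
      refine ⟨r, 1 - x, ?_⟩
      ext i j
      fin_cases i <;> fin_cases j <;> simp [Matrix.mul_apply, Fin.sum_univ_two]
      · linear_combination -h
      · ring
      · ring
      · linear_combination -h
  unfold IsIdempotentPair
  rw [key, key]

/-- A PRINC domain: an integral domain in which every ideal generated by an idempotent pair
is principal. -/
structure IsPRINCDomain (R : Type*) [CommRing R] : Prop where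
  isDomain : IsDomain R
  isPrincipal : ∀ a b : R, IsIdempotentPair a b → (Ideal.span {a, b}).IsPrincipal

/-- Seminormality in the sense of Swan. -/
def IsSeminormal (R : Type*) [CommRing R] : Prop :=
  ∀ a b : R, a ^ 2 = b ^ 3 → ∃ c : R, c ^ 3 = a ∧ c ^ 2 = b

/-- A commutative additive semigroup (with `0`) is locally cyclic if for all `s₁, s₂`
there is `s` with `s₁ ℕ + s₂ ℕ ⊆ s ℕ`. -/
def IsLocallyCyclic (S : Type*) [AddCommMonoid S] : Prop :=
  ∀ s₁ s₂ : S, ∃ s : S,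
    AddSubmonoid.multiples s₁ ⊔ AddSubmonoid.multiples s₂ ≤ AddSubmonoid.multiples s

namespace TowerRing

/-- The ideal of `D[X_n : n > 0]` generated by all `X_i - X_{i+1} (1 + X_{i+1})`. -/
noncomputable def relIdeal (D : Type*) [CommRing D] : Ideal (MvPolynomial ℕ+ D) :=
  Ideal.span (Set.range fun i : ℕ+ =>
    (MvPolynomial.X i - MvPolynomial.X (i + 1) * (1 + MvPolynomial.X (i + 1)) :
      MvPolynomial ℕ+ D))

end TowerRing

/-- The `D`-algebra generated by elements `x_n`, `n > 0`, subject to the relations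
`x_n = x_{n+1} (1 + x_{n+1})`. -/
abbrev TowerRing (D : Type*) [CommRing D] : Type _ :=
  MvPolynomial ℕ+ D ⧸ TowerRing.relIdeal D

/-- The generator `x_n` of the tower ring, the residue class of `X_n`. -/
noncomputable def TowerRing.x (D : Type*) [CommRing D] (n : ℕ+) : TowerRing D :=
  Ideal.Quotient.mk (TowerRing.relIdeal D) (MvPolynomial.X n)

/-!
The heart of the matter is that `D[X]` is again a PRINC domain (`IsPRINCDomain.polynomial`). Both
rings of the theorem are directed unions of subrings isomorphic to `D` or `D[X]`, and being a PRINC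
domain passes to such unions (`IsPRINCDomain.of_forall_exists_injective`), because an instance of
`b ∣ a * (1 - a)` involves only three elements.

Over a domain, the PRINC property says that every `2 × 2` matrix `M` of determinant `0` and trace
`1` is a column times a row, `M i j = f i * g j` with `∑ i, f i * g i = 1`; see
`IsRankOneSplitting`. Such a splitting is unique up to a unit.

Let `M` be such a matrix over `D[X]`. It splits over `K[X]`, where `K` is the fraction field of `D`,
since `K[X]` is a principal ideal domain; and its value at `X = 0` splits over `D`. After a rescaling
the two splittings agree at `X = 0`. The coefficients of `f` and `g` are then integral over `D`
(`IsRankOneSplitting.isIntegral_coeff_left`), so they generate a finite extension `B` of `D` in `K`.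
It remains to see that `B = D` (`IsRankOneSplitting.bot_eq_top`). Let `C` be the conductor of `B`
over `D`. Seminormality makes `C` a radical ideal of `B`. If `C ≠ B`, choose a prime `P` of `D`
minimal over `C ∩ D`, and localize `B ⧸ C` at `P`. The result `L` is reduced, and `P` becomes zero
in it, so the residue field `κ` of `P` maps to `L`. The matrix `M` splits over `κ[X]`, with the same
value at `X = 0`, and units of `L[X]` are constant, so uniqueness shows that `f` and `g` have
coefficients in the image of `κ`. Hence every element of `B` is carried into `D` by some `s ∉ P`; as
`B` is finite over `D`, one `s ∉ P` works for all of them, and then `s ∈ C ∩ D ⊆ P`, a contradiction.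
-/

open Polynomial

/-! ### Rank-one splittings -/

/-- The matrix `M` is the column `f` times the row `g`, and `g` times `f` is `1`. Equivalently, `M` is
an idempotent matrix whose image is free of rank one, with basis `f`. -/
structure IsRankOneSplitting {ι R : Type*} [Fintype ι] [CommRing R] (M : Matrix ι ι R)
    (f g : ι → R) : Prop where
  mul_eq : ∀ i j, f i * g j = M i j
  sum_eq_one : ∑ i, f i * g i = 1

theorem Matrix.map_mapRingHom_map_eval_zero {ι R S : Type*} [CommRing R] [CommRing S]
    (φ : R →+* S) (M : Matrix ι ι R[X]) :
    (M.map (mapRingHom φ)).map (evalRingHom 0) = (M.map (evalRingHom 0)).map φ := by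
  ext i j
  simp only [Matrix.map_apply, coe_mapRingHom, coe_evalRingHom, eval_zero_map]

namespace IsRankOneSplitting

variable {ι R S : Type*} [Fintype ι] [CommRing R] [CommRing S] {M : Matrix ι ι R} {f g : ι → R}

theorem transpose (h : IsRankOneSplitting M f g) : IsRankOneSplitting M.transpose g f where
  mul_eq i j := by rw [mul_comm, h.mul_eq, Matrix.transpose_apply]
  sum_eq_one := by simpa only [mul_comm] using h.sum_eq_one

theorem map (h : IsRankOneSplitting M f g) (φ : R →+* S) :
    IsRankOneSplitting (M.map φ) (fun i => φ (f i)) (fun i => φ (g i)) where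
  mul_eq i j := by rw [← map_mul, h.mul_eq, Matrix.map_apply]
  sum_eq_one := by simp only [← map_mul, ← map_sum, h.sum_eq_one, map_one]

theorem of_map {φ : R →+* S} (hφ : Function.Injective φ)
    (h : IsRankOneSplitting (M.map φ) (fun i => φ (f i)) (fun i => φ (g i))) :
    IsRankOneSplitting M f g where
  mul_eq i j := hφ (by rw [map_mul, h.mul_eq, Matrix.map_apply])
  sum_eq_one := hφ (by simpa only [map_mul, map_sum, map_one] using h.sum_eq_one)

/-- Two splittings of the same matrix differ by the unit `∑ i, f i * g' i`; see also `left_eq_mul`. -/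
theorem sum_mul_sum_eq_one (h : IsRankOneSplitting M f g) {f' g' : ι → R}
    (h' : IsRankOneSplitting M f' g') :
    (∑ i, f i * g' i) * (∑ i, f' i * g i) = 1 := by
  have key : ∀ i j, f i * g' i * (f' j * g j) = f i * g i * (f' j * g' j) := by
    intro i j
    have e : f' j * g' i = f j * g i := by rw [h'.mul_eq, h.mul_eq]
    have e' : f i * g j = f' i * g' j := by rw [h'.mul_eq, h.mul_eq]
    have e3 : f j * g j = f' j * g' j := by rw [h'.mul_eq, h.mul_eq]
    calc f i * g' i * (f' j * g j) = f i * g j * (f' j * g' i) := by ring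
      _ = f i * g j * (f j * g i) := by rw [e]
      _ = f i * g i * (f j * g j) := by ring
      _ = _ := by rw [e3]
  rw [Finset.sum_mul_sum]
  simp_rw [key]
  rw [← Finset.sum_mul_sum, h.sum_eq_one, h'.sum_eq_one, one_mul]

theorem left_eq_mul (h : IsRankOneSplitting M f g) {f' g' : ι → R}
    (h' : IsRankOneSplitting M f' g') (j : ι) : f j = f' j * ∑ i, f i * g' i := by
  have key : ∀ i, f' j * (f i * g' i) = f j * (f i * g i) := by
    intro i
    have e : f' j * g' i = f j * g i := by rw [h'.mul_eq, h.mul_eq]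
    linear_combination f i * e
  simp_rw [Finset.mul_sum, key, ← Finset.mul_sum, h.sum_eq_one, mul_one]

theorem smul (h : IsRankOneSplitting M f g) {u v : R} (huv : u * v = 1) :
    IsRankOneSplitting M (fun i => f i * u) (fun i => g i * v) where
  mul_eq i j := by rw [← h.mul_eq]; linear_combination f i * g j * huv
  sum_eq_one := by
    rw [← h.sum_eq_one]
    exact Finset.sum_congr rfl fun i _ => by linear_combination f i * g i * huv

/-- A splitting over `R[X]` can be rescaled by a constant so that it specializes at `X = 0` to a given
splitting over `R`. -/
theorem exists_eval_zero_eq {M : Matrix ι ι R[X]} {f g : ι → R[X]}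
    (h : IsRankOneSplitting M f g) {f₀ g₀ : ι → R}
    (h₀ : IsRankOneSplitting (M.map (evalRingHom 0)) f₀ g₀) :
    ∃ f g : ι → R[X], IsRankOneSplitting M f g ∧
      (∀ i, (f i).eval 0 = f₀ i) ∧ ∀ i, (g i).eval 0 = g₀ i := by
  have he := h.map (evalRingHom (0 : R))
  have huv := h₀.sum_mul_sum_eq_one he
  have hf := h₀.left_eq_mul he
  have hg := h₀.transpose.left_eq_mul he.transpose
  refine ⟨_, _, h.smul (u := C (∑ i, f₀ i * (evalRingHom 0) (g i)))
    (v := C (∑ i, (evalRingHom 0) (f i) * g₀ i)) (by rw [← C_mul, huv, C_1]), ?_, ?_⟩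
  · intro i
    rw [eval_mul, eval_C]
    exact (hf i).symm
  · intro i
    rw [eval_mul, eval_C]
    rw [hg i]
    simp only [coe_evalRingHom, mul_comm (g₀ _)]

/-- Over a reduced ring, a splitting over `R[X]` is determined by its value at `X = 0`, because units
of `R[X]` are constant. -/
theorem left_eq_of_eval_zero_eq [IsReduced R] {M : Matrix ι ι R[X]} {f g f' g' : ι → R[X]}
    (h : IsRankOneSplitting M f g) (h' : IsRankOneSplitting M f' g')
    (hf : ∀ i, (f i).eval 0 = (f' i).eval 0) : f = f' := by
  have hu : IsUnit (∑ i, f i * g' i) := .of_mul_eq_one _ (h.sum_mul_sum_eq_one h')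
  have hnil := (isUnit_iff_coeff_isUnit_isNilpotent.mp hu).2
  have hconst : (∑ i, f i * g' i) = C ((∑ i, f i * g' i).coeff 0) := by
    ext n
    rcases eq_or_ne n 0 with rfl | hn
    · simp
    · rw [(hnil n hn).eq_zero, coeff_C_of_ne_zero hn]
  have hone : (∑ i, f i * g' i) = 1 := by
    rw [hconst, coeff_zero_eq_eval_zero, eval_finsetSum]
    simp_rw [eval_mul, hf, ← eval_mul]
    rw [← eval_finsetSum, h'.sum_eq_one, eval_one, C_1]
  funext j
  rw [h.left_eq_mul h' j, hone, mul_one]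

end IsRankOneSplitting

/-! ### Integrality of the coefficients -/

theorem reverse_monic_of_eval_zero_eq_one {R : Type*} [CommRing R] {p : R[X]}
    (hp : p.eval 0 = 1) : p.reverse.Monic := by
  nontriviality R
  rw [← coeff_zero_eq_eval_zero] at hp
  have h0 : p.natTrailingDegree = 0 := natTrailingDegree_eq_zero.mpr (.inr (by simp [hp]))
  rw [Monic, reverse_leadingCoeff, trailingCoeff, h0, hp]

/-- Reversal turns `p`, `q` and `h` into monic polynomials, and monic factors of a monic polynomial
over `D` have integral coefficients. -/
theorem isIntegral_coeff_of_mul_eq_map {D K : Type*} [CommRing D] [Field K] [Algebra D K]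
    (hinj : Function.Injective (algebraMap D K)) {p q : K[X]} (hp : p.eval 0 = 1)
    (hq : q.eval 0 = 1) {h : D[X]} (hpq : p * q = h.map (algebraMap D K)) (n : ℕ) :
    IsIntegral D (p.coeff n) := by
  have hh : h.eval 0 = 1 := by
    apply hinj
    rw [map_one, ← coeff_zero_eq_eval_zero, ← coeff_map, ← hpq, coeff_zero_eq_eval_zero,
      eval_mul, hp, hq, one_mul]
  have hrev : h.reverse.map (algebraMap D K) = p.reverse * q.reverse := by
    rw [← reverse_mul_of_domain, hpq, reverse, reverse, natDegree_map_eq_of_injective hinj,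
      reflect_map]
  have key := isIntegral_coeff_of_dvd h.reverse p.reverse (reverse_monic_of_eval_zero_eq_one hh)
    (reverse_monic_of_eval_zero_eq_one hp) (hrev ▸ dvd_mul_right _ _) (revAt p.natDegree n)
  rwa [coeff_reverse, revAt_invol] at key

/-- The polynomial `F = ∑ i, g₀ i * f i` has value `1` at `0`, as has `G = ∑ j, f₀ j * g j`, and both
`F * G` and `f i * G` have coefficients in `D`. So `F` and `F + X * f i` are factors with constant
term `1` of polynomials over `D`. -/
theorem IsRankOneSplitting.isIntegral_coeff_left {ι D K : Type*} [Fintype ι] [CommRing D] [Field K]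
    [Algebra D K] (hinj : Function.Injective (algebraMap D K)) {M : Matrix ι ι D[X]}
    {f g : ι → K[X]} (h : IsRankOneSplitting (M.map (mapRingHom (algebraMap D K))) f g)
    {f₀ g₀ : ι → D} (h₀ : IsRankOneSplitting (M.map (evalRingHom 0)) f₀ g₀)
    (hf : ∀ i, (f i).eval 0 = algebraMap D K (f₀ i))
    (hg : ∀ i, (g i).eval 0 = algebraMap D K (g₀ i)) (i : ι) (n : ℕ) :
    IsIntegral D ((f i).coeff n) := by
  set F : K[X] := ∑ i, f i * C (algebraMap D K (g₀ i)) with hF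
  set G : K[X] := ∑ j, g j * C (algebraMap D K (f₀ j)) with hG
  have hF0 : F.eval 0 = 1 := by
    rw [hF, eval_finsetSum]
    simp only [eval_mul, eval_C, hf, ← map_mul]
    rw [← map_sum, h₀.sum_eq_one, map_one]
  have hG0 : G.eval 0 = 1 := by
    rw [hG, eval_finsetSum]
    simp only [eval_mul, eval_C, hg, ← map_mul, mul_comm (g₀ _)]
    rw [← map_sum, h₀.sum_eq_one, map_one]
  have hfG : ∀ i, f i * G = (∑ j, M i j * C (f₀ j)).map (algebraMap D K) := by
    intro i
    rw [hG, Finset.mul_sum, Polynomial.map_sum]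
    refine Finset.sum_congr rfl fun j _ => ?_
    rw [← mul_assoc, h.mul_eq, Polynomial.map_mul, map_C, Matrix.map_apply, coe_mapRingHom]
  have hFG : F * G = (∑ i, (∑ j, M i j * C (f₀ j)) * C (g₀ i)).map (algebraMap D K) := by
    rw [hF, Finset.sum_mul, Polynomial.map_sum]
    refine Finset.sum_congr rfl fun j _ => ?_
    rw [Polynomial.map_mul, ← hfG, map_C]
    ring
  have h1 := isIntegral_coeff_of_mul_eq_map hinj hF0 hG0 hFG (n + 1)
  have h2 := isIntegral_coeff_of_mul_eq_map (p := F + X * f i) hinj (by simp [hF0]) hG0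
    (h := (∑ i, (∑ j, M i j * C (f₀ j)) * C (g₀ i)) + X * (∑ j, M i j * C (f₀ j)))
    (by rw [Polynomial.map_add, Polynomial.map_mul, map_X, ← hfG, ← hFG]; ring) (n + 1)
  simpa [coeff_X_mul] using h2.sub h1

/-! ### PRINC domains in terms of splittings -/

theorem IsPRINCDomain.exists_isRankOneSplitting {R : Type*} [CommRing R] (hR : IsPRINCDomain R)
    (M : Matrix (Fin 2) (Fin 2) R) (hdet : M.det = 0) (htr : M.trace = 1) :
    ∃ f g, IsRankOneSplitting M f g := by
  have := hR.isDomain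
  rw [Matrix.det_fin_two] at hdet
  rw [Matrix.trace_fin_two] at htr
  obtain ⟨d, hd⟩ := hR.isPrincipal (M 0 0) (M 0 1)
    ((isIdempotentPair_iff _ _).mpr (.inl ⟨M 1 0, by linear_combination hdet - M 0 0 * htr⟩))
  rw [Ideal.submodule_span_eq] at hd
  obtain ⟨x, hx⟩ := Ideal.mem_span_singleton.mp
    (hd ▸ Ideal.subset_span (by simp) : M 0 0 ∈ Ideal.span {d})
  obtain ⟨y, hy⟩ := Ideal.mem_span_singleton.mp
    (hd ▸ Ideal.subset_span (by simp) : M 0 1 ∈ Ideal.span {d})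
  obtain ⟨p, q, hpq⟩ := Ideal.mem_span_pair.mp
    (hd ▸ Ideal.mem_span_singleton_self d : d ∈ Ideal.span {M 0 0, M 0 1})
  -- If `d = 0` the first row vanishes, and `M` is its own second row times the column `(0, 1)`.
  rcases eq_or_ne d 0 with rfl | hd0
  · rw [zero_mul] at hx hy
    refine ⟨![0, 1], ![M 1 0, 1], ?_, by simp⟩
    intro i j
    fin_cases i <;> fin_cases j
    · simp [hx]
    · simp [hy]
    · simp
    · simpa [hx] using htr.symm
  · have h1 : p * x + q * y = 1 := mul_left_cancel₀ hd0 (by linear_combination hpq - p * hx - q * hy)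
    have h2 : M 1 0 * y = x * (1 - M 0 0) := mul_left_cancel₀ hd0 (by
      linear_combination -hdet - M 1 0 * hy + (1 - M 0 0) * hx + M 0 0 * htr)
    have h3 : M 1 1 = 1 - M 0 0 := by linear_combination htr
    refine ⟨![d, p * M 1 0 + q * (1 - M 0 0)], ![x, y], ?_, ?_⟩
    · intro i j
      fin_cases i <;> fin_cases j
      · simp [hx]
      · simp [hy]
      · change (p * M 1 0 + q * (1 - M 0 0)) * x = M 1 0
        linear_combination M 1 0 * h1 - q * h2
      · change (p * M 1 0 + q * (1 - M 0 0)) * y = M 1 1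
        rw [h3]
        linear_combination (1 - M 0 0) * h1 + p * h2
    · simp only [Fin.sum_univ_two, Matrix.cons_val_zero, Matrix.cons_val_one]
      linear_combination p * h2 + (1 - M 0 0) * h1 - hx

theorem isPrincipal_span_pair_of_forall_dvd {R : Type*} [CommRing R]
    (h : ∀ a b : R, b ∣ a * (1 - a) → (Ideal.span {a, b}).IsPrincipal) (a b : R)
    (hab : IsIdempotentPair a b) : (Ideal.span {a, b}).IsPrincipal := by
  rcases (isIdempotentPair_iff a b).mp hab with hab | hab
  · exact h a b hab
  · rw [Set.pair_comm]
    exact h b a hab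

theorem isPRINCDomain_of_exists_isRankOneSplitting {R : Type*} [CommRing R] [IsDomain R]
    (h : ∀ M : Matrix (Fin 2) (Fin 2) R, M.det = 0 → M.trace = 1 →
      ∃ f g, IsRankOneSplitting M f g) : IsPRINCDomain R where
  isDomain := ‹_›
  isPrincipal := by
    refine isPrincipal_span_pair_of_forall_dvd ?_
    rintro a b ⟨c, hc⟩
    obtain ⟨f, g, hfg⟩ := h !![a, b; c, 1 - a]
      (by rw [Matrix.det_fin_two_of]; linear_combination hc) (by simp [Matrix.trace_fin_two])
    have h00 : f 0 * g 0 = a := hfg.mul_eq 0 0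
    have h01 : f 0 * g 1 = b := hfg.mul_eq 0 1
    have hs := hfg.sum_eq_one
    rw [Fin.sum_univ_two] at hs
    refine ⟨f 0, le_antisymm ?_ ?_⟩
    · rw [Ideal.span_le, Set.pair_subset_iff, ← h00, ← h01]
      exact ⟨Ideal.mem_span_singleton.mpr (dvd_mul_right _ _),
        Ideal.mem_span_singleton.mpr (dvd_mul_right _ _)⟩
    · rw [Ideal.submodule_span_eq, Ideal.span_singleton_le_iff_mem, Ideal.mem_span_pair]
      exact ⟨f 0, f 1, by rw [← h00, ← h01]; linear_combination f 0 * hs⟩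

theorem IsPRINCDomain.of_isPrincipalIdealRing (R : Type*) [CommRing R] [IsDomain R]
    [IsPrincipalIdealRing R] : IsPRINCDomain R :=
  ⟨‹_›, fun _ _ _ => IsPrincipalIdealRing.principal _⟩

/-! ### The conductor of a seminormal extension -/

/-- A radical ideal agrees with each of its minimal primes after localization at that prime. -/
theorem exists_notMem_mul_mem_of_mem_minimalPrimes {R : Type*} [CommRing R] {I P : Ideal R}
    (hI : I.IsRadical) (hP : P ∈ I.minimalPrimes) {x : R} (hx : x ∈ P) : ∃ s ∉ P, s * x ∈ I := by
  have hprime : P.IsPrime := hP.1.1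
  have hmem : algebraMap R (Localization.AtPrime P) x ∈
      (I.map (algebraMap R (Localization.AtPrime P))).radical := by
    rw [IsLocalization.AtPrime.radical_map_of_mem_minimalPrimes _ P I hP]
    exact Ideal.mem_map_of_mem _ hx
  obtain ⟨n, hn⟩ := hmem
  rw [← map_pow, IsLocalization.algebraMap_mem_map_algebraMap_iff P.primeCompl] at hn
  obtain ⟨s, hs, hsx⟩ := hn
  refine ⟨s, hs, hI ⟨n + 1, ?_⟩⟩
  rw [show (s * x) ^ (n + 1) = s ^ n * x * (s * x ^ n) by ring]
  exact I.mul_mem_left _ hsx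

/-- The conductor of `B` over `D`: the largest ideal of `B` that lies in the image of `D`, which is
written as the subalgebra `⊥`. -/
def extensionConductor (D B : Type*) [CommRing D] [CommRing B] [Algebra D B] : Ideal B where
  carrier := {b | ∀ b', b * b' ∈ (⊥ : Subalgebra D B)}
  add_mem' hx hy b' := by rw [add_mul]; exact add_mem (hx b') (hy b')
  zero_mem' b' := by rw [zero_mul]; exact zero_mem _
  smul_mem' c x hx b' := by rw [smul_eq_mul, mul_comm c, mul_assoc]; exact hx _

theorem mem_bot_of_mem_extensionConductor {D B : Type*} [CommRing D] [CommRing B] [Algebra D B]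
    {b : B} (hb : b ∈ extensionConductor D B) : b ∈ (⊥ : Subalgebra D B) := by
  simpa using hb 1

/-- If `b ^ 2` is in the conductor, then the square and the cube of any multiple of `b` lie in `D`. -/
theorem isRadical_extensionConductor {D B : Type*} [CommRing D] [CommRing B] [Algebra D B]
    (hsn : ∀ b : B, b ^ 2 ∈ (⊥ : Subalgebra D B) → b ^ 3 ∈ (⊥ : Subalgebra D B) →
      b ∈ (⊥ : Subalgebra D B)) : (extensionConductor D B).IsRadical := by
  rw [Ideal.isRadical_iff_quotient_reduced]
  refine (isReduced_iff_pow_one_lt 2 one_lt_two).mpr fun q hq => ?_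
  obtain ⟨b, rfl⟩ := Ideal.Quotient.mk_surjective q
  rw [← map_pow, Ideal.Quotient.eq_zero_iff_mem] at hq
  rw [Ideal.Quotient.eq_zero_iff_mem]
  intro b'
  refine hsn _ ?_ ?_
  · rw [mul_pow]
    exact hq _
  · rw [show (b * b') ^ 3 = b ^ 2 * (b * b' ^ 3) by ring]
    exact hq _

/-! ### Descent of splittings along a finite seminormal extension -/

/-- If the radical ideal `C` of `B` lies in `D` and becomes equal to `P` in `D` after localization at
`P`, then, locally at `P`, the coefficients of `f` lie in `D`: modulo `C` the splitting agrees with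
one over the residue field of `P`. -/
theorem IsRankOneSplitting.exists_smul_coeff_mem_bot {ι : Type*} [Fintype ι] {D B : Type*}
    [CommRing D] [CommRing B] [Algebra D B] {M : Matrix ι ι D[X]} {f g : ι → B[X]}
    (h : IsRankOneSplitting (M.map (mapRingHom (algebraMap D B))) f g)
    {f₀ g₀ : ι → D} (h₀ : IsRankOneSplitting (M.map (evalRingHom 0)) f₀ g₀)
    (hf : ∀ i, (f i).eval 0 = algebraMap D B (f₀ i))
    {C : Ideal B} (hC : C.IsRadical) (hCD : ∀ b ∈ C, b ∈ (⊥ : Subalgebra D B))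
    {P : Ideal D} [P.IsPrime] (hP : ∀ p ∈ P, ∃ s ∉ P, algebraMap D B (s * p) ∈ C)
    (hκ : ∃ f' g', IsRankOneSplitting
      (M.map (mapRingHom (algebraMap D (FractionRing (D ⧸ P))))) f' g')
    (i : ι) (n : ℕ) :
    ∃ s ∉ P, s • (f i).coeff n ∈ (⊥ : Subalgebra D B) := by
  set T := Algebra.algebraMapSubmonoid (B ⧸ C) P.primeCompl with hT
  let L := Localization T
  have : IsReduced (B ⧸ C) := (Ideal.isRadical_iff_quotient_reduced C).mp hC
  let β : B →+* L := (algebraMap (B ⧸ C) L).comp (Ideal.Quotient.mk C)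
  let ψ : D →+* L := β.comp (algebraMap D B)
  have hunit : ∀ s ∉ P, IsUnit (ψ s) := fun s hs =>
    IsLocalization.map_units L (⟨_, s, hs, rfl⟩ : T)
  have hker : ∀ p ∈ P, ψ p = 0 := by
    intro p hp
    obtain ⟨s, hs, hsp⟩ := hP p hp
    refine (hunit s hs).mul_right_eq_zero.mp ?_
    rw [← map_mul]
    change algebraMap (B ⧸ C) L (Ideal.Quotient.mk C _) = 0
    rw [Ideal.Quotient.eq_zero_iff_mem.mpr hsp, map_zero]
  -- The map `θ` from the residue field `κ` of `P` to `L`.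
  let ψ' : D ⧸ P →+* L := Ideal.Quotient.lift P ψ hker
  have hunit' : ∀ y : nonZeroDivisors (D ⧸ P), IsUnit (ψ' y) := by
    rintro ⟨y, hy⟩
    obtain ⟨s, rfl⟩ := Ideal.Quotient.mk_surjective y
    refine hunit s fun hs => nonZeroDivisors.ne_zero hy ?_
    rwa [Ideal.Quotient.eq_zero_iff_mem]
  let κ := FractionRing (D ⧸ P)
  let φ : D →+* κ := algebraMap D κ
  let θ : κ →+* L := IsLocalization.lift hunit'
  have hθ' : ∀ y : D ⧸ P, θ (algebraMap (D ⧸ P) κ y) = ψ' y := fun y => IsLocalization.lift_eq _ y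
  have hθ : ∀ d, θ (φ d) = ψ d := fun d => hθ' (Ideal.Quotient.mk P d)
  obtain ⟨f', g', h'⟩ := hκ
  have h₀' : IsRankOneSplitting ((M.map (mapRingHom φ)).map (evalRingHom 0)) (fun i => φ (f₀ i))
      (fun i => φ (g₀ i)) := by
    rw [Matrix.map_mapRingHom_map_eval_zero]
    exact h₀.map φ
  obtain ⟨f', g', h', hf', -⟩ := h'.exists_eval_zero_eq h₀'
  have hL := h.map (S := L[X]) (mapRingHom β)
  have hL' := h'.map (S := L[X]) (mapRingHom θ)
  have hM : (M.map (mapRingHom (algebraMap D B))).map (mapRingHom β) =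
      (M.map (mapRingHom φ)).map (mapRingHom θ) := by
    ext i j n
    simp only [Matrix.map_apply, coe_mapRingHom, coeff_map, hθ]
    rfl
  rw [hM] at hL
  -- The splittings from `B[X]` and from `κ[X]` agree at `X = 0`, so they agree over `L[X]`.
  have heq := hL.left_eq_of_eval_zero_eq hL' fun i => by
    simp only [coe_mapRingHom, eval_zero_map, hf, hf', hθ]
    rfl
  have hcoeff : β ((f i).coeff n) = θ ((f' i).coeff n) := by
    simpa using congrArg (fun p => p.coeff n) (congrFun heq i)
  -- Write the coefficient in `κ` as `d / s`, and clear denominators in `L`.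
  obtain ⟨⟨d, s, hs⟩, hds⟩ := IsLocalization.surj (nonZeroDivisors (D ⧸ P)) ((f' i).coeff n)
  obtain ⟨d, rfl⟩ := Ideal.Quotient.mk_surjective d
  obtain ⟨s, rfl⟩ := Ideal.Quotient.mk_surjective s
  have hsP : s ∉ P := fun h => nonZeroDivisors.ne_zero hs (Ideal.Quotient.eq_zero_iff_mem.mpr h)
  have hβ : β ((f i).coeff n * algebraMap D B s) = β (algebraMap D B d) := by
    have := congrArg θ hds
    rw [map_mul, hθ', hθ', ← hcoeff] at this
    rw [map_mul]
    exact this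
  obtain ⟨⟨_, t, ht, rfl⟩, hc⟩ := (IsLocalization.eq_iff_exists T L).mp hβ
  refine ⟨t * s, P.primeCompl.mul_mem ht hsP, ?_⟩
  have hmem : algebraMap D B t * ((f i).coeff n * algebraMap D B s) -
      algebraMap D B t * algebraMap D B d ∈ C := by
    rw [← Ideal.Quotient.eq_zero_iff_mem, map_sub, sub_eq_zero]
    exact hc
  have := add_mem (hCD _ hmem) (Subalgebra.algebraMap_mem (⊥ : Subalgebra D B) (t * d))
  rw [Algebra.smul_def]
  convert this using 1
  simp only [map_mul]
  ring

/-- A finite seminormal extension generated by the coefficients of a splitting of a matrix over `D[X]`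
is trivial, if the splitting is defined over `D` at `X = 0` and the matrix also splits over the
residue field of every prime of `D`. -/
theorem IsRankOneSplitting.bot_eq_top {ι : Type*} [Fintype ι] {D B : Type*}
    [CommRing D] [CommRing B] [Algebra D B] [Module.Finite D B]
    (hsn : ∀ b : B, b ^ 2 ∈ (⊥ : Subalgebra D B) → b ^ 3 ∈ (⊥ : Subalgebra D B) →
      b ∈ (⊥ : Subalgebra D B))
    {M : Matrix ι ι D[X]} {f g : ι → B[X]}
    (h : IsRankOneSplitting (M.map (mapRingHom (algebraMap D B))) f g)
    {f₀ g₀ : ι → D} (h₀ : IsRankOneSplitting (M.map (evalRingHom 0)) f₀ g₀)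
    (hf : ∀ i, (f i).eval 0 = algebraMap D B (f₀ i))
    (hg : ∀ i, (g i).eval 0 = algebraMap D B (g₀ i))
    (hκ : ∀ (P : Ideal D) [P.IsPrime], ∃ f' g', IsRankOneSplitting
      (M.map (mapRingHom (algebraMap D (FractionRing (D ⧸ P))))) f' g')
    (hgen : Algebra.adjoin D ({b | ∃ i n, (f i).coeff n = b} ∪ {b | ∃ i n, (g i).coeff n = b})
      = ⊤) :
    (⊥ : Subalgebra D B) = ⊤ := by
  classical
  set C := extensionConductor D B with hCdef
  have hC : C.IsRadical := isRadical_extensionConductor hsn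
  by_contra hne
  have hc : C.comap (algebraMap D B) ≠ ⊤ := by
    intro htop
    refine hne (eq_top_iff.mpr fun b _ => ?_)
    have h1 : algebraMap D B 1 ∈ C := (Ideal.eq_top_iff_one _).mp htop
    simpa using h1 b
  obtain ⟨P, hPmin⟩ := Ideal.nonempty_minimalPrimes hc
  have hprime : P.IsPrime := hPmin.1.1
  have hP : ∀ p ∈ P, ∃ s ∉ P, algebraMap D B (s * p) ∈ C := fun p hp =>
    exists_notMem_mul_mem_of_mem_minimalPrimes (hC.comap _) hPmin hp
  have hloc : ∀ b : B, ∃ s ∉ P, s • b ∈ (⊥ : Subalgebra D B) := by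
    intro b
    have hb : b ∈ Algebra.adjoin D
        ({b | ∃ i n, (f i).coeff n = b} ∪ {b | ∃ i n, (g i).coeff n = b}) := hgen ▸ trivial
    induction hb using Algebra.adjoin_induction with
    | mem x hx =>
      obtain ⟨i, n, rfl⟩ | ⟨i, n, rfl⟩ := hx
      · exact h.exists_smul_coeff_mem_bot h₀ hf hC
          (fun _ => mem_bot_of_mem_extensionConductor) hP (hκ P) i n
      · refine h.transpose.exists_smul_coeff_mem_bot (M := M.transpose) h₀.transpose hg hC
          (fun _ => mem_bot_of_mem_extensionConductor) hP ?_ i n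
        obtain ⟨f', g', h'⟩ := hκ P
        exact ⟨g', f', h'.transpose⟩
    | algebraMap r =>
      exact ⟨1, P.one_notMem, by rw [one_smul]; exact Subalgebra.algebraMap_mem _ _⟩
    | add x y _ _ hx hy =>
      obtain ⟨s, hs, hsx⟩ := hx
      obtain ⟨t, ht, hty⟩ := hy
      refine ⟨s * t, P.primeCompl.mul_mem hs ht, ?_⟩
      rw [smul_add, mul_comm, mul_smul, mul_comm, mul_smul]
      exact add_mem (Subalgebra.smul_mem _ hsx t) (Subalgebra.smul_mem _ hty s)
    | mul x y _ _ hx hy =>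
      obtain ⟨s, hs, hsx⟩ := hx
      obtain ⟨t, ht, hty⟩ := hy
      refine ⟨s * t, P.primeCompl.mul_mem hs ht, ?_⟩
      rw [← smul_mul_smul_comm]
      exact mul_mem hsx hty
  obtain ⟨G, hG⟩ := (Module.Finite.fg_top : (⊤ : Submodule D B).FG)
  choose s hsP hs using hloc
  -- The product of the denominators of a finite set of module generators lies in the conductor.
  have hmem : algebraMap D B (∏ b ∈ G, s b) ∈ C := by
    intro b'
    rw [← Algebra.smul_def]
    have hb' : b' ∈ Submodule.span D (G : Set B) := hG ▸ trivial
    induction hb' using Submodule.span_induction with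
    | mem x hx =>
      rw [← Finset.prod_erase_mul _ _ hx, mul_smul]
      exact Subalgebra.smul_mem _ (hs x) _
    | zero => rw [smul_zero]; exact zero_mem _
    | add x y _ _ hx hy => rw [smul_add]; exact add_mem hx hy
    | smul a x _ hx => rw [smul_comm]; exact Subalgebra.smul_mem _ hx _
  exact (P.primeCompl.prod_mem fun b _ => hsP b) (hPmin.1.2 hmem)

/-! ### Polynomial rings over seminormal PRINC domains -/

theorem IsPRINCDomain.polynomial {D : Type*} [CommRing D] (hD : IsPRINCDomain D)
    (hsn : IsSeminormal D) : IsPRINCDomain D[X] := by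
  have := hD.isDomain
  refine isPRINCDomain_of_exists_isRankOneSplitting fun M hdet htr => ?_
  have hsplit : ∀ {E : Type _} [CommRing E], IsPRINCDomain E → ∀ φ : D[X] →+* E,
      ∃ f g, IsRankOneSplitting (M.map φ) f g := fun hE φ =>
    hE.exists_isRankOneSplitting _ (by rw [← RingHom.mapMatrix_apply, ← RingHom.map_det, hdet,
      map_zero]) (by rw [← AddMonoidHom.map_trace φ, htr, map_one])
  let K := FractionRing D
  have hinj : Function.Injective (algebraMap D K) := IsFractionRing.injective D K
  obtain ⟨f₀, g₀, h₀⟩ := hsplit hD (evalRingHom 0)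
  obtain ⟨f, g, h⟩ := hsplit (.of_isPrincipalIdealRing K[X]) (mapRingHom (algebraMap D K))
  have h₀K : IsRankOneSplitting ((M.map (mapRingHom (algebraMap D K))).map (evalRingHom 0))
      (fun i => algebraMap D K (f₀ i)) (fun i => algebraMap D K (g₀ i)) := by
    rw [Matrix.map_mapRingHom_map_eval_zero]
    exact h₀.map (algebraMap D K)
  obtain ⟨f, g, h, hf, hg⟩ := h.exists_eval_zero_eq h₀K
  set s : Set K := {b | ∃ i n, (f i).coeff n = b} ∪ {b | ∃ i n, (g i).coeff n = b} with hs
  have hsfin : s.Finite := by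
    have hfin : ∀ p : Fin 2 → K[X], {b | ∃ i n, (p i).coeff n = b}.Finite := fun p => by
      convert Set.finite_iUnion fun i => finite_range_coeff (p i)
      ext; simp
    exact (hfin f).union (hfin g)
  have hsint : ∀ x ∈ s, IsIntegral D x := by
    rintro _ (⟨i, n, rfl⟩ | ⟨i, n, rfl⟩)
    · exact h.isIntegral_coeff_left hinj h₀ hf hg i n
    · exact h.transpose.isIntegral_coeff_left (M := M.transpose) hinj h₀.transpose hg hf i n
  let B := Algebra.adjoin D s
  have : Module.Finite D B := Module.Finite.iff_fg.mpr (fg_adjoin_of_finite hsfin hsint)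
  have hlift : ∀ p : K[X], (∀ n, p.coeff n ∈ B) → ∃ q : B[X], q.map (algebraMap B K) = p :=
    fun p hp => (mem_lifts p).mp ((lifts_iff_coeff_lifts p).mpr fun n => ⟨⟨_, hp n⟩, rfl⟩)
  choose fB hfB using fun i => hlift (f i) fun n =>
    Algebra.subset_adjoin (.inl ⟨i, n, rfl⟩)
  choose gB hgB using fun i => hlift (g i) fun n =>
    Algebra.subset_adjoin (.inr ⟨i, n, rfl⟩)
  have hBinj : Function.Injective (algebraMap B K) := Subtype.val_injective
  have hDB : ∀ d : D, algebraMap B K (algebraMap D B d) = algebraMap D K d := fun _ => rfl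
  have hB : IsRankOneSplitting (M.map (mapRingHom (algebraMap D B))) fB gB := by
    refine .of_map (φ := mapRingHom (algebraMap B K)) (map_injective _ hBinj) ?_
    simp only [coe_mapRingHom, hfB, hgB]
    convert h using 1
    ext i j n
    simp [hDB]
  -- Seminormality of `D` gives `c` with `c ^ 2 = b ^ 2` and `c ^ 3 = b ^ 3`, whence `c = b`.
  have hbot : (⊥ : Subalgebra D B) = ⊤ := by
    refine hB.bot_eq_top ?_ h₀ ?_ ?_ ?_ ?_
    · rintro b ⟨a, ha⟩ ⟨a', ha'⟩
      change algebraMap D B a = b ^ 2 at ha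
      change algebraMap D B a' = b ^ 3 at ha'
      have hDBinj : Function.Injective (algebraMap D B) := FaithfulSMul.algebraMap_injective D B
      obtain ⟨c, hc3, hc2⟩ := hsn a' a (hDBinj (by rw [map_pow, map_pow, ha, ha']; ring))
      refine ⟨c, ?_⟩
      change algebraMap D B c = b
      have h2 : algebraMap D B c ^ 2 = b ^ 2 := by rw [← map_pow, hc2, ha]
      have h3 : algebraMap D B c ^ 3 = b ^ 3 := by rw [← map_pow, hc3, ha']
      rcases eq_or_ne b 0 with rfl | hb
      · exact pow_eq_zero_iff (two_ne_zero) |>.mp (by rw [h2]; simp)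
      · refine mul_left_cancel₀ (pow_ne_zero 2 hb) ?_
        linear_combination h3 - algebraMap D B c * h2
    · exact fun i => hBinj (by rw [← eval_zero_map, hfB, hf, hDB])
    · exact fun i => hBinj (by rw [← eval_zero_map, hgB, hg, hDB])
    · intro P _
      exact hsplit (.of_isPrincipalIdealRing (FractionRing (D ⧸ P))[X]) _
    · rw [← Algebra.adjoin_adjoin_coe_preimage (R := D) (s := s)]
      congr 1
      ext b
      simp only [hs, Set.mem_preimage, Set.mem_union, Set.mem_ofPred_eq, ← hfB, ← hgB, coeff_map]
      simp only [← hBinj.eq_iff (b := b)]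
      rfl
  have hdesc : ∀ q : B[X], ∃ p : D[X], p.map (algebraMap D B) = q := fun q =>
    (mem_lifts q).mp ((lifts_iff_coeff_lifts q).mpr fun n => by
      have : q.coeff n ∈ (⊥ : Subalgebra D B) := hbot ▸ trivial
      exact this)
  choose fD hfD using fun i => hdesc (fB i)
  choose gD hgD using fun i => hdesc (gB i)
  refine ⟨fD, gD, .of_map (S := B[X]) (φ := mapRingHom (algebraMap D B))
    (map_injective _ (FaithfulSMul.algebraMap_injective D B)) ?_⟩
  simpa only [coe_mapRingHom, hfD, hgD] using hB

/-! ### Directed unions -/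

universe u in
theorem IsPRINCDomain.of_forall_exists_injective {R : Type*} [CommRing R]
    (h : ∀ a b c : R, ∃ (A : Type u) (_ : CommRing A) (φ : A →+* R), IsPRINCDomain A ∧
      Function.Injective φ ∧ a ∈ φ.range ∧ b ∈ φ.range ∧ c ∈ φ.range) : IsPRINCDomain R where
  isDomain := by
    have hnt : Nontrivial R := by
      obtain ⟨A, _, φ, hA, hφ, -⟩ := h 0 0 0
      have := hA.isDomain
      exact hφ.nontrivial
    have hnz : NoZeroDivisors R := by
      refine ⟨fun {a b} hab => ?_⟩
      obtain ⟨A, _, φ, hA, hφ, ⟨a, rfl⟩, ⟨b, rfl⟩, -⟩ := h a b 0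
      have := hA.isDomain
      rw [← map_mul, map_eq_zero_iff φ hφ, mul_eq_zero] at hab
      exact hab.imp (by rintro rfl; exact map_zero φ) (by rintro rfl; exact map_zero φ)
    exact NoZeroDivisors.to_isDomain R
  isPrincipal := by
    refine isPrincipal_span_pair_of_forall_dvd ?_
    rintro a b ⟨c, hc⟩
    obtain ⟨A, _, φ, hA, hφ, ⟨a, rfl⟩, ⟨b, rfl⟩, ⟨c, rfl⟩⟩ := h a b c
    obtain ⟨d, hd⟩ := hA.isPrincipal a b ((isIdempotentPair_iff _ _).mpr
      (.inl ⟨c, hφ (by rw [map_mul, map_sub, map_one, hc, map_mul])⟩))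
    refine ⟨φ d, ?_⟩
    have := congrArg (Ideal.map φ) hd
    rw [Ideal.submodule_span_eq, Ideal.map_span, Ideal.map_span, Set.image_pair,
      Set.image_singleton] at this
    exact this

/-! ### Semigroup rings -/

theorem IsLocallyCyclic.exists_forall_mem_multiples {S : Type*} [AddCommMonoid S]
    (hS : IsLocallyCyclic S) (t : Finset S) :
    ∃ s, ∀ x ∈ t, x ∈ AddSubmonoid.multiples s := by
  classical
  induction t using Finset.induction_on with
  | empty => exact ⟨0, by simp⟩
  | insert a t _ ih =>
    obtain ⟨s, hs⟩ := ih
    obtain ⟨r, hr⟩ := hS a s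
    obtain ⟨hra, hrs⟩ := sup_le_iff.mp hr
    refine ⟨r, fun x hx => ?_⟩
    rcases Finset.mem_insert.mp hx with rfl | hx
    · exact hra (AddSubmonoid.mem_multiples x)
    · exact hrs (hs x hx)

theorem nsmul_left_injective_of_ne_zero {S : Type*} [AddCancelCommMonoid S] [IsAddTorsionFree S]
    {s : S} (hs : s ≠ 0) : Function.Injective fun n : ℕ => n • s := by
  have key : ∀ m k : ℕ, m • s = (m + k) • s → k = 0 := by
    intro m k h
    rw [add_nsmul, left_eq_add] at h
    by_contra hk
    exact hs (IsAddTorsionFree.nsmul_right_injective hk (by simpa using h))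
  intro m n h
  rcases le_total m n with hmn | hmn <;> obtain ⟨k, rfl⟩ := Nat.exists_eq_add_of_le hmn
  · rw [key m k h, add_zero]
  · rw [key n k h.symm, add_zero]

theorem IsPRINCDomain.addMonoidAlgebra {D : Type*} [CommRing D] (hD : IsPRINCDomain D)
    (hDX : IsPRINCDomain D[X]) {S : Type*} [AddCancelCommMonoid S] [IsAddTorsionFree S]
    (hS : IsLocallyCyclic S) : IsPRINCDomain (AddMonoidAlgebra D S) := by
  classical
  refine .of_forall_exists_injective fun a b c => ?_
  obtain ⟨s, hs⟩ := hS.exists_forall_mem_multiples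
    (a.coeff.support ∪ b.coeff.support ∪ c.coeff.support)
  have ha : ∀ x ∈ a.coeff.support, x ∈ AddSubmonoid.multiples s := fun x hx => hs x (by simp_all)
  have hb : ∀ x ∈ b.coeff.support, x ∈ AddSubmonoid.multiples s := fun x hx => hs x (by simp_all)
  have hc : ∀ x ∈ c.coeff.support, x ∈ AddSubmonoid.multiples s := fun x hx => hs x (by simp_all)
  -- The three elements lie in the semigroup ring of `s ℕ`, which is `D` or a copy of `D[X]`.
  rcases eq_or_ne s 0 with rfl | hs0
  · have hrange : ∀ p : AddMonoidAlgebra D S,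
        (∀ x ∈ p.coeff.support, x ∈ AddSubmonoid.multiples (0 : S)) →
        p ∈ (AddMonoidAlgebra.singleZeroRingHom : D →+* AddMonoidAlgebra D S).range := by
      intro p hp
      refine ⟨p.coeff 0, ?_⟩
      ext x
      rcases eq_or_ne x 0 with rfl | hx
      · simp [AddMonoidAlgebra.singleZeroRingHom]
      · have : p.coeff x = 0 := by
          by_contra hne
          obtain ⟨n, hn⟩ := hp x (Finsupp.mem_support_iff.mpr hne)
          exact hx (by simpa using hn.symm)
        simp [AddMonoidAlgebra.singleZeroRingHom, hx.symm, this]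
    exact ⟨D, _, AddMonoidAlgebra.singleZeroRingHom, hD, AddMonoidAlgebra.single_right_injective,
      hrange a ha, hrange b hb, hrange c hc⟩
  · have hinj := nsmul_left_injective_of_ne_zero hs0
    let φ : D[X] →+* AddMonoidAlgebra D S :=
      (AddMonoidAlgebra.mapDomainRingHom D (multiplesHom S s)).comp
        (toFinsuppIso D : D[X] →+* AddMonoidAlgebra D ℕ)
    have hrange : ∀ p : AddMonoidAlgebra D S,
        (∀ x ∈ p.coeff.support, x ∈ AddSubmonoid.multiples s) → p ∈ φ.range := fun p hp =>
      ⟨(toFinsuppIso D).symm (.comapDomain _ hinj p), by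
        change AddMonoidAlgebra.mapDomain (multiplesHom S s)
          (toFinsuppIso D ((toFinsuppIso D).symm _)) = p
        rw [RingEquiv.apply_symm_apply]
        exact AddMonoidAlgebra.mapDomain_comapDomain (fun x hx => hp x hx) hinj⟩
    exact ⟨D[X], _, φ, hDX,
      (AddMonoidAlgebra.mapDomain_injective hinj).comp (toFinsuppIso D).injective,
      hrange a ha, hrange b hb, hrange c hc⟩

/-! ### The tower ring -/

namespace TowerRing

variable (D : Type*) [CommRing D]

theorem x_eq (n : ℕ+) : x D n = x D (n + 1) * (1 + x D (n + 1)) := by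
  have : MvPolynomial.X n - MvPolynomial.X (n + 1) * (1 + MvPolynomial.X (n + 1)) ∈ relIdeal D :=
    Ideal.subset_span ⟨n, rfl⟩
  simpa [x] using Ideal.Quotient.eq.mpr this

theorem adjoin_x_mono : Monotone fun n => Algebra.adjoin D {x D n} := by
  refine monotone_of_le_succ fun n _ => Algebra.adjoin_singleton_le ?_
  change x D n ∈ Algebra.adjoin D {x D (n + 1)}
  have h := Algebra.self_mem_adjoin_singleton D (x D (n + 1))
  rw [x_eq D n]
  exact mul_mem h (add_mem (one_mem _) h)

theorem exists_mem_adjoin_x (a : TowerRing D) : ∃ n, a ∈ Algebra.adjoin D {x D n} := by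
  obtain ⟨p, rfl⟩ := Ideal.Quotient.mk_surjective a
  induction p using MvPolynomial.induction_on with
  | C r => exact ⟨1, Subalgebra.algebraMap_mem _ r⟩
  | add p q hp hq =>
    obtain ⟨m, hm⟩ := hp
    obtain ⟨n, hn⟩ := hq
    refine ⟨max m n, ?_⟩
    rw [map_add]
    exact add_mem (adjoin_x_mono D (le_max_left m n) hm) (adjoin_x_mono D (le_max_right m n) hn)
  | mul_X p i hp =>
    obtain ⟨m, hm⟩ := hp
    refine ⟨max m i, ?_⟩
    rw [map_mul]
    exact mul_mem (adjoin_x_mono D (le_max_left m i) hm)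
      (adjoin_x_mono D (le_max_right m i) (Algebra.self_mem_adjoin_singleton D (x D i)))

/-- Over an algebraically closed field containing `D[X]` one can start from the transcendental element
`X` and solve the equations `z = y * (1 + y)` successively. All solutions are transcendental, and
they form an image of the generators `x_n`. -/
theorem transcendental_x [IsDomain D] (n : ℕ+) : Transcendental D (x D n) := by
  let F := AlgebraicClosure (FractionRing D[X])
  have hroot : ∀ z : F, ∃ y : F, z = y * (1 + y) := by
    intro z
    obtain ⟨y, hy⟩ := IsAlgClosed.exists_root (X ^ 2 + X - C z : F[X])
      (by rw [show (X ^ 2 + X - C z : F[X]) = C 1 * X ^ 2 + C 1 * X + C (-z) by simp; ring,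
        degree_quadratic one_ne_zero]; norm_num)
    refine ⟨y, ?_⟩
    simp only [IsRoot.def, eval_sub, eval_add, eval_pow, eval_X, eval_C] at hy
    linear_combination -hy
  choose r hr using hroot
  let y : ℕ → F := fun n => r^[n] (algebraMap D[X] F X)
  have hy : ∀ n, y n = y (n + 1) * (1 + y (n + 1)) := fun n => by
    simp only [y, Function.iterate_succ_apply']
    exact hr _
  have htr : ∀ n, Transcendental D (y n) := by
    intro n
    induction n with
    | zero =>
      have hinj : Function.Injective (algebraMap D[X] F) :=
        (algebraMap (FractionRing D[X]) F).injective.comp (IsFractionRing.injective D[X] _)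
      exact (transcendental_algebraMap_iff hinj).mpr
        (Polynomial.transcendental_X D)
    | succ n ih =>
      intro halg
      refine ih ?_
      rw [hy]
      exact halg.mul (isAlgebraic_one.add halg)
  let ev : MvPolynomial ℕ+ D →ₐ[D] F := MvPolynomial.aeval fun n => y n.natPred
  have hev : ∀ p ∈ relIdeal D, ev p = 0 := by
    suffices relIdeal D ≤ RingHom.ker ev from fun p hp => this hp
    refine Ideal.span_le.mpr ?_
    rintro _ ⟨i, rfl⟩
    have : (i + 1).natPred = i.natPred + 1 := by
      rw [PNat.natPred, PNat.natPred, PNat.add_coe, PNat.one_coe]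
      have := i.pos
      omega
    simp only [SetLike.mem_coe, RingHom.mem_ker, map_sub, map_mul, map_add, map_one, ev,
      MvPolynomial.aeval_X, this]
    rw [sub_eq_zero]
    exact hy _
  intro halg
  have := halg.algHom (Ideal.Quotient.liftₐ (relIdeal D) ev hev)
  refine htr n.natPred ?_
  convert this
  change _ = ev (MvPolynomial.X n)
  simp [ev]

theorem isPRINCDomain [IsDomain D] (hDX : IsPRINCDomain D[X]) : IsPRINCDomain (TowerRing D) := by
  refine .of_forall_exists_injective fun a b c => ?_
  obtain ⟨k, hk⟩ := exists_mem_adjoin_x D a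
  obtain ⟨l, hl⟩ := exists_mem_adjoin_x D b
  obtain ⟨m, hm⟩ := exists_mem_adjoin_x D c
  have hmem : ∀ {j : ℕ+} {z : TowerRing D}, z ∈ Algebra.adjoin D {x D j} → j ≤ max k (max l m) →
      z ∈ (aeval (x D (max k (max l m))) : D[X] →ₐ[D] TowerRing D).toRingHom.range := by
    intro j z hz hj
    have : z ∈ Algebra.adjoin D {x D (max k (max l m))} := adjoin_x_mono D hj hz
    rw [Algebra.adjoin_singleton_eq_range_aeval] at this
    exact this
  exact ⟨D[X], _, _, hDX, transcendental_iff_injective.mp (transcendental_x D _),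
    hmem hk (by simp), hmem hl (by simp), hmem hm (by simp)⟩

end TowerRing

theorem mainTheorem6 {D : Type*} [CommRing D] (hD : IsPRINCDomain D) (hsn : IsSeminormal D) :
    (∀ (S : Type*) [AddCancelCommMonoid S] [IsAddTorsionFree S],
      IsLocallyCyclic S → IsPRINCDomain (AddMonoidAlgebra D S)) ∧
    ((∀ n : ℕ+, TowerRing.x D n = TowerRing.x D (n + 1) * (1 + TowerRing.x D (n + 1))) ∧
      (⋃ n : ℕ+, (Algebra.adjoin D {TowerRing.x D n} : Set (TowerRing D))) = Set.univ ∧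
      IsPRINCDomain (TowerRing D)) := by
  have := hD.isDomain
  have hDX := hD.polynomial hsn
  exact ⟨fun S _ _ hS => hD.addMonoidAlgebra hDX hS, TowerRing.x_eq D,
    Set.eq_univ_of_forall fun a => Set.mem_iUnion.mpr (TowerRing.exists_mem_adjoin_x D a),
    TowerRing.isPRINCDomain D hDX⟩
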